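/- **Setting.** Let $\mathfrak B$ be a real Banach space, $\mathfrak X$ a real Hilbert space, $\Theta\subset\mathfrak B$, and let $m:\Theta\to\mathfrak X$ be Fréchet differentiable, with derivative $\nabla m(\theta)$ at $\theta$. Let $m_n(\theta)$, $\theta\in\Theta$, be random $\mathfrak X$-valued estimates of $m(\theta)$ defined on probability spaces $(\Omega_n,P_n)$ (no measurability is required; probabilities and expectations are outer ones), and let $(r_n)$ be real numbers. Let $\mathcal T$ be the closed unit ball of $\mathfrak X^*$, and put $v(\theta,t)=t(m(\theta))$, $v_n(\theta,t)=t(m_n(\theta))$, $\ell(\theta)=\sup_{t\in\mathcal T}v(\theta,t)$, $\Theta_0=\{\theta\in\Theta:\ell(\theta)=0\}$, $\mathbb G_n(\theta,t)=r_n(v_n(\theta,t)-v(\theta,t))$ and $$T_n=r_n\inf_{\theta\in\Theta}\sup_{t\in\mathcal T}v_n(\theta,t).$$ **Assumptions.** 1. $\Theta$ is compact; every $\theta\in\Theta_0$ has a ball around it whose intersection with $\Theta$ is convex; $\ell$ is finite, nonnegative and lower semicontinuous on $\Theta$. 2. $r_n\to\infty$; $\mathbb G_n$ has bounded sample paths and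 converges weakly (in the Hoffmann-Jørgensen sense) in $L^\infty(\Theta\times\mathcal T)$ to a tight Borel limit; and $\mathbb G_n$ is asymptotically uniformly equicontinuous in probability with respect to a pseudometric $\rho$ on $\Theta\times\mathcal T$. 3. For all $(\theta,t)\in\Theta_0\times\mathcal T$ there is a lower semicontinuous, convex, positively homogeneous functional $D_{\theta;t}v:\mathfrak B\to\mathbb R$, and there is a function $f_v$ with $f_v(\delta)=o(\delta)$ as $\delta\downarrow0$, such that $$\sup_{\theta\in\Theta_0,\ \theta'\in\Theta,\ t\in\mathcal T,\ \|\theta'-\theta\|\le\delta}|v(\theta',t)-v(\theta,t)-D_{\theta;t}v(\theta'-\theta)|=O(f_v(\delta));$$ moreover, for all $n$, $\theta\in\Theta_0$, $\theta'\in\Theta$, the map $t\mapsto v_n(\theta,t)+D_{\theta;t}v(\theta'-\theta)$ is almost surely quasi-concave on $\mathcal T$. 4. $\mathcal T$ carries a topology $\mathcal U$ for which $\mathcal T$ is compact, $\rho$ is continuous for the product topology on $\Theta\times\mathcal T$ (that is, $x_\alpha\to x$ implies $\rho(x_\alpha,x)\to0$), and for all $\theta\in\Theta_0$, $\theta'\in\Theta$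 the maps $t\mapsto D_{\theta;t}v(\theta'-\theta)$ and (for every $n$, almost surely) $t\mapsto v_n(\theta,t)+D_{\theta;t}v(\theta'-\theta)$ are upper semicontinuous. 5. $\Theta_0$ is nonempty and contained in the interior of $\Theta$ in $\mathfrak B$. For $\theta\in\Theta_0$ and $t\in\mathcal T$ let $$\gamma(\theta,t)=\liminf_{\delta\downarrow0}\ \inf_{\theta'\in\Theta,\ \|\theta'-\theta\|\le\delta}\frac{D_{\theta;t}v(\theta'-\theta)}{\delta},\qquad K(\theta)=\{t\in\mathcal T:\gamma(\theta,t)=0\},$$ and let $M_{\nabla m(\theta)}$ be the orthogonal projection of $\mathfrak X$ onto the orthogonal complement of the closure of the image of $\nabla m(\theta):\mathfrak B\to\mathfrak X$. **Conclusion.** One has $\ell(\theta)=\|m(\theta)\|_{\mathfrak X}$ for $\theta\in\Theta$; for every $\theta\in\Theta_0$, $$K(\theta)=\{t\in\mathcal T:\ t(\nabla m(\theta)h)=0\ \text{ for all } h\in\mathfrak B\};$$ and $$T_n\le\inf_{\theta\in\Theta_0}\bigl\|M_{\nabla m(\theta)}\,r_n(m_n(\theta)-m(\theta))\bigr\|_{\mathfrak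 X}+o_p(1).$$ Moreover $r_n(m_n-m)$ converges weakly in $L^\infty(\Theta;\mathfrak X)$ to a tight Borel limit $\mathbb W$, and $$\inf_{\theta\in\Theta_0}\bigl\|M_{\nabla m(\theta)}\,r_n(m_n(\theta)-m(\theta))\bigr\|_{\mathfrak X}\rightsquigarrow\inf_{\theta\in\Theta_0}\bigl\|M_{\nabla m(\theta)}\mathbb W(\theta)\bigr\|_{\mathfrak X}.$$ -/

import Mathlib

open Set Filter Topology MeasureTheory
open scoped ENNReal BoundedContinuousFunction

noncomputable section

namespace MinimaxTest

/-! ### Outer expectations, weak convergence of arbitrary maps, and `o_p(1)` -/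

/-- The space `L^∞(ι; F)` of bounded maps from `ι` to `F`, with the uniform norm. -/
abbrev LInf (ι : Type*) (F : Type*) [NormedAddCommGroup F] : Type _ :=
  lp (fun _ : ι => F) ∞

/-- `L^∞(ι; F)` carries its Borel σ-algebra. -/
instance LInf.instMeasurableSpace (ι : Type*) (F : Type*) [NormedAddCommGroup F] :
    MeasurableSpace (LInf ι F) := borel _

instance LInf.instBorelSpace (ι : Type*) (F : Type*) [NormedAddCommGroup F] :
    BorelSpace (LInf ι F) := ⟨rfl⟩

/-- Outer expectation of a bounded, not necessarily measurable, `Z`: the infimum of `E U` over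
measurable integrable `U ≥ Z`. -/
def outerExp {Ω : Type*} [MeasurableSpace Ω] (P : Measure Ω) (Z : Ω → ℝ) : ℝ :=
  sInf {a : ℝ | ∃ U : Ω → ℝ, Measurable U ∧ Integrable U P ∧ (∀ ω, Z ω ≤ U ω) ∧ a = ∫ ω, U ω ∂P}

/-- Weak convergence (in the sense of Hoffmann-Jørgensen) of arbitrary maps `X n : Ω n → D` to a
Borel law `μ` on `D`: `E* f(X n) → ∫ f dμ` for every bounded continuous `f`. -/
def ConvergesWeakly {Ω : ℕ → Type*} [∀ n, MeasurableSpace (Ω n)] (P : ∀ n, Measure (Ω n))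
    {D : Type*} [TopologicalSpace D] [MeasurableSpace D]
    (X : ∀ n, Ω n → D) (μ : Measure D) : Prop :=
  ∀ f : D →ᵇ ℝ, Tendsto (fun n => outerExp (P n) (fun ω => f (X n ω))) atTop (𝓝 (∫ x, f x ∂μ))

/-- `R n = o_p(1)`, in outer probability (a `Measure` applied to a nonmeasurable set is its outer
measure). -/
def IsLittleOp {Ω : ℕ → Type*} [∀ n, MeasurableSpace (Ω n)] (P : ∀ n, Measure (Ω n))
    (R : ∀ n, Ω n → ℝ) : Prop :=
  ∀ ε : ℝ, 0 < ε → Tendsto (fun n => P n {ω | ε < |R n ω|}) atTop (𝓝 0)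

/-- Asymptotic uniform equicontinuity in probability with respect to a pseudometric `ρ`. -/
def AsymptoticallyEquicontinuous {Ω : ℕ → Type*} [∀ n, MeasurableSpace (Ω n)]
    (P : ∀ n, Measure (Ω n)) {ι : Type*} (ρ : PseudoMetric ι ℝ) (G : ∀ n, Ω n → ι → ℝ) : Prop :=
  ∀ ε : ℝ, 0 < ε → ∀ η : ℝ≥0∞, 0 < η → ∃ δ : ℝ, 0 < δ ∧
    limsup (fun n => P n {ω | ∃ x y, ρ x y < δ ∧ ε < |G n ω x - G n ω y|}) atTop < η

/-! ### The minimax model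

`Θ` is the parameter space inside `B`, `T` the set of test functions inside a linear space `E`,
`v` the population test functions, `vn` their random estimates, and `D θ t` the directional
derivative of `v (·) t` at `θ`. Values of `v`, `vn`, `D` outside `Θ` and `T` play no role. -/

section Model

variable {B : Type*} [NormedAddCommGroup B] [NormedSpace ℝ B]
  {E : Type*} [AddCommGroup E] [Module ℝ E]

/-- The criterion `ℓ(θ) = sup_{t ∈ T} v(θ, t)`. -/
def criterion (T : Set E) (v : B → E → ℝ) (θ : B) : ℝ := ⨆ t : T, v θ t

/-- The identified set `Θ₀ = {θ ∈ Θ : ℓ(θ) = 0}`. -/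
def identifiedSet (Θ : Set B) (T : Set E) (v : B → E → ℝ) : Set B :=
  {θ ∈ Θ | criterion T v θ = 0}

/-- The test statistic `T_n = r_n inf_{θ ∈ Θ} sup_{t ∈ T} v_n(θ, t)` (for one `n` and one sample). -/
def testStatistic (Θ : Set B) (T : Set E) (rn : ℝ) (vn : B → E → ℝ) : ℝ :=
  rn * ⨅ θ : Θ, criterion T vn θ

/-- Regularity of the model: `Θ` is compact and locally convex near the identified set, `T` is
convex, and `ℓ` is a well-defined, nonnegative and lower semicontinuous function on `Θ`. -/
structure RegularModel (Θ : Set B) (T : Set E) (v : B → E → ℝ) : Prop where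
  isCompact : IsCompact Θ
  locallyConvex : ∀ θ ∈ identifiedSet Θ T v, ∃ ε : ℝ, 0 < ε ∧ Convex ℝ (Θ ∩ Metric.ball θ ε)
  nonempty : T.Nonempty
  convex : Convex ℝ T
  bddAbove : ∀ θ ∈ Θ, BddAbove (range fun t : T => v θ t)
  nonneg : ∀ θ ∈ Θ, 0 ≤ criterion T v θ
  lowerSemicontinuousOn : LowerSemicontinuousOn (criterion T v) Θ

/-- The empirical process `G_n(θ, t) = r_n (v_n(θ, t) - v(θ, t))` on `Θ × T`. -/
def empiricalProcess {Ω : ℕ → Type*} (Θ : Set B) (T : Set E) (v : B → E → ℝ)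
    (vn : ∀ n, Ω n → B → E → ℝ) (r : ℕ → ℝ) (n : ℕ) (ω : Ω n) (x : Θ × T) : ℝ :=
  r n * (vn n ω x.1 x.2 - v x.1 x.2)

/-- `r_n → ∞`, the empirical process converges weakly in `L^∞(Θ × T)` to a tight Borel limit, and
it is asymptotically equicontinuous with respect to the pseudometric `ρ`. -/
structure EmpiricalCLT {Ω : ℕ → Type*} [∀ n, MeasurableSpace (Ω n)] (P : ∀ n, Measure (Ω n))
    (Θ : Set B) (T : Set E) (v : B → E → ℝ) (vn : ∀ n, Ω n → B → E → ℝ) (r : ℕ → ℝ)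
    (ρ : PseudoMetric (Θ × T) ℝ) : Prop where
  tendsto_rate : Tendsto r atTop atTop
  weak_limit : ∃ (G : ∀ n, Ω n → LInf (Θ × T) ℝ) (μ : Measure (LInf (Θ × T) ℝ)),
    (∀ n ω x, G n ω x = empiricalProcess Θ T v vn r n ω x) ∧
    IsProbabilityMeasure μ ∧ IsTightMeasureSet {μ} ∧ ConvergesWeakly P G μ
  equicontinuous : AsymptoticallyEquicontinuous P ρ (empiricalProcess Θ T v vn r)

/-- Local approximation of `v` at the identified set by lower semicontinuous, convex, positively
homogeneous functionals `D θ t`, with a remainder that is `O(f(δ))` uniformly, `f(δ) = o(δ)`, and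
almost sure quasi-concavity in `t` of the linearised estimate. -/
structure UniformlyApproximable {Ω : ℕ → Type*} [∀ n, MeasurableSpace (Ω n)]
    (P : ∀ n, Measure (Ω n)) (Θ : Set B) (T : Set E) (v : B → E → ℝ)
    (vn : ∀ n, Ω n → B → E → ℝ) (D : B → E → B → ℝ) : Prop where
  lowerSemicontinuous : ∀ θ ∈ identifiedSet Θ T v, ∀ t ∈ T, LowerSemicontinuous (D θ t)
  convexOn : ∀ θ ∈ identifiedSet Θ T v, ∀ t ∈ T, ConvexOn ℝ univ (D θ t)
  posHomogeneous : ∀ θ ∈ identifiedSet Θ T v, ∀ t ∈ T, ∀ c : ℝ, 0 ≤ c → ∀ h : B,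
    D θ t (c • h) = c * D θ t h
  remainder : ∃ f : ℝ → ℝ, f =o[𝓝[>] 0] (fun δ : ℝ => δ) ∧
    ∃ C : ℝ, ∀ᶠ δ : ℝ in 𝓝[>] 0, ∀ θ ∈ identifiedSet Θ T v, ∀ θ' ∈ Θ, ∀ t ∈ T, ‖θ' - θ‖ ≤ δ →
      |v θ' t - v θ t - D θ t (θ' - θ)| ≤ C * |f δ|
  quasiconcave : ∀ n, ∀ θ ∈ identifiedSet Θ T v, ∀ θ' ∈ Θ,
    ∀ᵐ ω ∂(P n), QuasiconcaveOn ℝ T (fun t => vn n ω θ t + D θ t (θ' - θ))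

/-- The topology `U` on `T` is compact, makes `ρ` continuous on `Θ × T` (in the sense that
`x_α → x` implies `ρ(x_α, x) → 0`), and makes the linearised maps upper semicontinuous. -/
structure CompactTests {Ω : ℕ → Type*} [∀ n, MeasurableSpace (Ω n)]
    (P : ∀ n, Measure (Ω n)) (Θ : Set B) (T : Set E) (v : B → E → ℝ)
    (vn : ∀ n, Ω n → B → E → ℝ) (D : B → E → B → ℝ)
    (ρ : PseudoMetric (Θ × T) ℝ) (U : TopologicalSpace T) : Prop where
  compactSpace : CompactSpace T
  continuous : ∀ x : Θ × T, Tendsto (fun y => ρ y x) (𝓝 x) (𝓝 0)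
  upperSemicontinuous : ∀ θ ∈ identifiedSet Θ T v, ∀ θ' ∈ Θ,
    UpperSemicontinuous (fun t : T => D θ t (θ' - θ))
  upperSemicontinuous_estimate : ∀ n, ∀ θ ∈ identifiedSet Θ T v, ∀ θ' ∈ Θ,
    ∀ᵐ ω ∂(P n), UpperSemicontinuous (fun t : T => vn n ω θ t + D θ t (θ' - θ))

/-- `γ(θ, t) = liminf_{δ ↓ 0} inf {D_{θ;t}(θ' - θ) / δ : θ' ∈ Θ, ‖θ' - θ‖ ≤ δ}`, taken in the
extended reals. -/
def gammaFun (Θ : Set B) (D : B → E → B → ℝ) (θ : B) (t : E) : EReal :=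
  liminf (fun δ : ℝ => ⨅ θ' ∈ {θ' ∈ Θ | ‖θ' - θ‖ ≤ δ}, ((D θ t (θ' - θ) / δ : ℝ) : EReal))
    (𝓝[>] (0 : ℝ))

/-- `K(θ) = {t ∈ T : γ(θ, t) = 0}`. -/
def zeroSet (Θ : Set B) (T : Set E) (D : B → E → B → ℝ) (θ : B) : Set E :=
  {t ∈ T | gammaFun Θ D θ t = 0}

end Model

/-- The orthogonal projection of `X` onto the orthogonal complement of the closure of the image of
the Fréchet derivative of `m` at `θ`. -/
def residualProj {B : Type*} [NormedAddCommGroup B] [NormedSpace ℝ B]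
    {X : Type*} [NormedAddCommGroup X] [InnerProductSpace ℝ X] [CompleteSpace X]
    (m : B → X) (θ : B) : X →L[ℝ] X :=
  ((LinearMap.range (fderiv ℝ m θ : B →ₗ[ℝ] X)).topologicalClosure)ᗮ.starProjection

end MinimaxTest

end

namespace MinimaxTest

/-! ### Outer expectations and weak convergence -/

section Outer

/-! The supremum of `t x` over the dual unit ball is `‖x‖`, so pairing embeds `L^∞(Θ; X)`
isometrically, with closed range, into `L^∞(Θ × T)`. A limit law of processes with values in a
closed set is carried by that set, and bounded continuous functions extend by Tietze. Hence the
tight limit of the empirical process pulls back to a tight limit of `r_n (m_n - m)`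
(`exists_convergesWeakly_of_pairing`).

At an interior point `θ` of the identified set the approximating functional must be `t ∘ ∇m(θ)`
(`eq_fderiv_of_remainder`), which also gives the description of `K(θ)`. Testing the infimum at `θ +
h / r_n` with `‖h‖ ≤ k` gives `r_n m_n(θ + h / r_n) = r_n (m_n - m)(θ) + ∇m(θ) h + o_p(1)`,
uniformly, so `T_n` is at most `localInf k + o_p(1)` for each fixed `k`
(`eventually_measure_localInf_lt`).

As `k → ∞`, `localInf k` tends pointwise to `residualInf`, because the distance from `x` to the
closed range of `A` is the norm of the projected residual (`tendsto_localInf`). Both functionals are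
continuous, so dominated convergence under the limit law followed by weak convergence makes the gap
small in outer probability (`isLittleOp_max_sub_residualInf`). The last convergence is continuous
mapping applied to `residualInf`. -/

lemma outerExp_zero {Ω : Type*} [MeasurableSpace Ω] (P : Measure Ω) :
    outerExp P (fun _ => 0) = 0 := by
  apply le_antisymm
  · refine csInf_le ⟨0, ?_⟩ ⟨fun _ => 0, measurable_const, integrable_zero _ _ _, fun _ => le_rfl,
      by simp⟩
    rintro a ⟨U, -, -, hU, rfl⟩
    exact integral_nonneg hU
  · refine Real.sInf_nonneg ?_
    rintro a ⟨U, -, -, hU, rfl⟩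
    exact integral_nonneg hU

/-- Markov's inequality for outer probabilities and outer expectations. -/
lemma measure_one_le_le_outerExp {Ω : Type*} [MeasurableSpace Ω] (P : Measure Ω)
    [IsFiniteMeasure P] {Z : Ω → ℝ} (h0 : ∀ ω, 0 ≤ Z ω) {C : ℝ} (hC : ∀ ω, Z ω ≤ C) :
    P {ω | 1 ≤ Z ω} ≤ ENNReal.ofReal (outerExp P Z) := by
  have hfin : P {ω | 1 ≤ Z ω} ≠ ∞ := measure_ne_top _ _
  rw [← ENNReal.ofReal_toReal hfin]
  apply ENNReal.ofReal_le_ofReal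
  -- The constant `C` is an integrable majorant, so the set defining the outer expectation is
  -- nonempty.
  refine le_csInf ⟨_, fun _ => C, measurable_const, integrable_const _, hC, rfl⟩ ?_
  rintro a ⟨U, hUm, hUi, hU, rfl⟩
  have h1 := mul_meas_ge_le_integral_of_nonneg
    (Eventually.of_forall fun ω => (h0 ω).trans (hU ω)) hUi 1
  rw [one_mul] at h1
  refine le_trans ?_ h1
  exact ENNReal.toReal_mono (measure_ne_top _ _) (measure_mono fun ω hω => le_trans hω (hU ω))

end Outer

namespace ConvergesWeakly

variable {Ω : ℕ → Type*} [∀ n, MeasurableSpace (Ω n)] {P : ∀ n, Measure (Ω n)}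

/-- The continuous mapping theorem. -/
lemma comp {D D' : Type*} [TopologicalSpace D] [MeasurableSpace D] [OpensMeasurableSpace D]
    [TopologicalSpace D'] [MeasurableSpace D'] [BorelSpace D']
    {X : ∀ n, Ω n → D} {μ : Measure D} (h : ConvergesWeakly P X μ) {g : D → D'}
    (hg : Continuous g) :
    ConvergesWeakly P (fun n ω => g (X n ω)) (μ.map g) := by
  intro f
  have := h (f.compContinuous ⟨g, hg⟩)
  rwa [integral_map hg.measurable.aemeasurable f.continuous.measurable.aestronglyMeasurable]

/-- A closed set which contains all values of the sequence carries the limit. -/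
lemma measure_compl_eq_zero {D : Type*} [PseudoMetricSpace D] [MeasurableSpace D]
    [OpensMeasurableSpace D] {X : ∀ n, Ω n → D} {μ : Measure D} [IsFiniteMeasure μ]
    (h : ConvergesWeakly P X μ) {S : Set D} (hS : IsClosed S) (hne : S.Nonempty)
    (hX : ∀ n ω, X n ω ∈ S) : μ Sᶜ = 0 := by
  -- The truncated distance to `S` vanishes along the sequence, hence has integral zero in the
  -- limit, yet is positive off `S`.
  have hc : Continuous fun x : D => min 1 (Metric.infDist x S) :=
    continuous_const.min (Metric.continuous_infDist_pt S)
  let f : D →ᵇ ℝ := BoundedContinuousFunction.ofNormedAddCommGroup _ hc 1 (fun x => by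
    rw [Real.norm_of_nonneg (le_min zero_le_one Metric.infDist_nonneg)]; exact min_le_left _ _)
  have hf : ∀ x, f x = min 1 (Metric.infDist x S) := fun x => rfl
  have h1 := h f
  have h2 : ∀ n, (fun ω => f (X n ω)) = fun _ => 0 := by
    intro n; ext ω
    rw [hf, Metric.infDist_zero_of_mem (hX n ω)]; simp
  simp only [h2, outerExp_zero] at h1
  have h3 : ∫ x, f x ∂μ = 0 := tendsto_nhds_unique h1 tendsto_const_nhds
  have hnn : 0 ≤ (f : D → ℝ) := fun x => le_min zero_le_one Metric.infDist_nonneg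
  rw [integral_eq_zero_iff_of_nonneg hnn (f.integrable μ)] at h3
  refine measure_mono_null ?_ h3
  intro x hx hfx
  have hpos := (hS.notMem_iff_infDist_pos hne).1 hx
  have : (0 : ℝ) < f x := lt_min one_pos hpos
  exact this.ne' hfx

/-- Weak convergence to a tight law can be pulled back along a closed embedding. -/
lemma exists_of_isClosedEmbedding [∀ n, Nonempty (Ω n)] {D D' : Type*}
    [MetricSpace D] [MeasurableSpace D]
    [BorelSpace D] [TopologicalSpace D'] [MeasurableSpace D'] [BorelSpace D']
    {e : D' → D} (he : IsClosedEmbedding e) {Y : ∀ n, Ω n → D'} {μ : Measure D}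
    [IsProbabilityMeasure μ] (hμ : IsTightMeasureSet {μ})
    (h : ConvergesWeakly P (fun n ω => e (Y n ω)) μ) :
    ∃ ν : Measure D', IsProbabilityMeasure ν ∧ IsTightMeasureSet {ν} ∧ ConvergesWeakly P Y ν := by
  have hme : MeasurableEmbedding e := he.measurableEmbedding
  have h0 : μ (range e)ᶜ = 0 :=
    h.measure_compl_eq_zero he.isClosed_range ⟨_, Y 0 (Classical.arbitrary _), rfl⟩
      fun n ω => ⟨_, rfl⟩
  have hmap : (μ.comap e).map e = μ := by
    rw [hme.map_comap, Measure.restrict_eq_self_of_ae_mem]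
    exact h0
  refine ⟨μ.comap e, ⟨?_⟩, ?_, ?_⟩
  · have := hme.map_apply (μ.comap e) univ
    rw [hmap, preimage_univ, measure_univ] at this
    exact this.symm
  · rw [isTightMeasureSet_iff_exists_isCompact_measure_compl_le] at hμ ⊢
    intro ε hε
    obtain ⟨K, hK, hKε⟩ := hμ ε hε
    refine ⟨e ⁻¹' K, he.isCompact_preimage hK, ?_⟩
    simp only [mem_singleton_iff, forall_eq] at hKε ⊢
    rw [← preimage_compl, ← hme.map_apply, hmap]
    exact hKε
  · intro f
    -- Tietze: a test function on the subspace extends to one on the ambient space.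
    obtain ⟨g, -, hg⟩ := f.exists_extension_norm_eq_of_isClosedEmbedding he
    have hg' : ∀ x, g (e x) = f x := fun x => congrFun hg x
    have h1 := h g
    simp only [hg'] at h1
    rwa [← hmap, hme.integral_map, funext hg'] at h1

/-- If `H k ↓ 0` pointwise, then `H k (Y n)` is small in outer probability for some `k` and
eventually in `n`. -/
lemma exists_eventually_measure_lt [∀ n, IsProbabilityMeasure (P n)] {D : Type*}
    [TopologicalSpace D] [MeasurableSpace D] [OpensMeasurableSpace D] {Y : ∀ n, Ω n → D}
    {ν : Measure D} [IsProbabilityMeasure ν] (h : ConvergesWeakly P Y ν) {H : ℕ → D → ℝ}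
    (hc : ∀ k, Continuous (H k)) (h0 : ∀ k x, 0 ≤ H k x)
    (hlim : ∀ x, Tendsto (fun k => H k x) atTop (𝓝 0)) {ε : ℝ} (hε : 0 < ε) {η : ℝ≥0∞}
    (hη : 0 < η) : ∃ k, ∀ᶠ n in atTop, P n {ω | ε ≤ H k (Y n ω)} < η := by
  have hc' : ∀ k, Continuous fun x => min 1 (H k x / ε) := fun k =>
    continuous_const.min ((hc k).div_const ε)
  have hnn : ∀ k x, 0 ≤ min 1 (H k x / ε) := fun k x =>
    le_min zero_le_one (div_nonneg (h0 k x) hε.le)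
  let f : ℕ → D →ᵇ ℝ := fun k => BoundedContinuousFunction.ofNormedAddCommGroup _ (hc' k) 1
    (fun x => by rw [Real.norm_of_nonneg (hnn k x)]; exact min_le_left _ _)
  have hf : ∀ k x, f k x = min 1 (H k x / ε) := fun k x => rfl
  -- First `k → ∞` under the limit law, then `n → ∞` with `k` fixed; truncation at 1 supplies both
  -- the dominating function and a bounded test function.
  have hint : Tendsto (fun k => ∫ x, f k x ∂ν) atTop (𝓝 (∫ _, (0 : ℝ) ∂ν)) := by
    refine tendsto_integral_of_dominated_convergence (fun _ => 1)
      (fun k => ((f k).integrable ν).aestronglyMeasurable) (integrable_const _)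
      (fun k => Eventually.of_forall fun x => ?_) (Eventually.of_forall fun x => ?_)
    · rw [hf, Real.norm_of_nonneg (hnn k x)]; exact min_le_left _ _
    · have : Tendsto (fun k => min 1 (H k x / ε)) atTop (𝓝 (min 1 (0 / ε))) :=
        tendsto_const_nhds.min ((hlim x).div_const ε)
      simpa [hf] using this
  rw [integral_zero] at hint
  have hof : Tendsto (fun k => ENNReal.ofReal (∫ x, f k x ∂ν)) atTop (𝓝 0) := by
    simpa using ENNReal.tendsto_ofReal hint
  obtain ⟨k, hk⟩ := (hof.eventually_lt_const hη).exists
  refine ⟨k, ?_⟩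
  filter_upwards [(ENNReal.tendsto_ofReal (h (f k))).eventually_lt_const hk] with n hn
  refine lt_of_le_of_lt ?_ hn
  refine le_trans (measure_mono ?_)
    (measure_one_le_le_outerExp (P n) (fun ω => hnn k (Y n ω)) (C := 1)
      fun ω => min_le_left _ _)
  intro ω hω
  exact le_min le_rfl ((one_le_div hε).2 hω)

end ConvergesWeakly

end MinimaxTest

noncomputable section

namespace MinimaxTest

/-! ### Infima of families of norms -/

lemma abs_iInf_sub_iInf_le {κ : Type*} [Nonempty κ] {f g : κ → ℝ} (hf : ∀ k, 0 ≤ f k)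
    (hg : ∀ k, 0 ≤ g k) {C : ℝ} (h : ∀ k, |f k - g k| ≤ C) : |(⨅ k, f k) - ⨅ k, g k| ≤ C := by
  have hbf : BddBelow (range f) := ⟨0, forall_mem_range.2 hf⟩
  have hbg : BddBelow (range g) := ⟨0, forall_mem_range.2 hg⟩
  rw [abs_sub_le_iff]
  constructor
  · rw [sub_le_iff_le_add', ← sub_le_iff_le_add]
    refine le_ciInf fun k => ?_
    have h1 := ciInf_le hbf k
    have h2 := (abs_sub_le_iff.1 (h k)).1
    linarith
  · rw [sub_le_iff_le_add', ← sub_le_iff_le_add]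
    refine le_ciInf fun k => ?_
    have h1 := ciInf_le hbg k
    have h2 := (abs_sub_le_iff.1 (h k)).2
    linarith

section LocalInf

variable {B : Type*} [NormedAddCommGroup B] [NormedSpace ℝ B]
  {X : Type*} [NormedAddCommGroup X] [NormedSpace ℝ X]
  {ι κ : Type*} (j : κ → ι) (A : κ → B →L[ℝ] X)

/-- The functional `w ↦ inf_{k, ‖h‖ ≤ R} ‖w(j k) + A k h‖`. -/
def localInf (R : ℝ) (w : ι → X) : ℝ :=
  ⨅ p : κ × Metric.closedBall (0 : B) R, ‖w (j p.1) + A p.1 p.2‖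

/-- An infimum of functions that are each 1-Lipschitz in the uniform norm is 1-Lipschitz. Continuity
lets the functional enter weak convergence. -/
lemma continuous_localInf [Nonempty κ] {R : ℝ} (hR : 0 ≤ R) :
    Continuous fun w : LInf ι X => localInf j A R w := by
  have : Nonempty (Metric.closedBall (0 : B) R) := ⟨⟨0, Metric.mem_closedBall_self hR⟩⟩
  refine (LipschitzWith.of_dist_le_mul (K := 1) fun w w' => ?_).continuous
  rw [NNReal.coe_one, one_mul, Real.dist_eq, dist_eq_norm]
  refine abs_iInf_sub_iInf_le (fun _ => norm_nonneg _) (fun _ => norm_nonneg _) fun p => ?_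
  refine (abs_norm_sub_norm_le _ _).trans ?_
  rw [add_sub_add_right_eq_sub]
  exact lp.norm_apply_le_norm ENNReal.top_ne_zero (w - w') (j p.1)

end LocalInf

/-! ### Distance to the closed range of a bounded operator. -/

section Residual

variable {B : Type*} [NormedAddCommGroup B] [NormedSpace ℝ B]
  {X : Type*} [NormedAddCommGroup X] [InnerProductSpace ℝ X] [CompleteSpace X]

/-- The orthogonal projection onto the orthogonal complement of the closed range of `A`. -/
def rangeResidual (A : B →L[ℝ] X) : X →L[ℝ] X :=
  ((LinearMap.range (A : B →ₗ[ℝ] X)).topologicalClosure)ᗮ.starProjection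

lemma norm_rangeResidual_le (A : B →L[ℝ] X) (x : X) : ‖rangeResidual A x‖ ≤ ‖x‖ :=
  Submodule.norm_starProjection_apply_le _ x

lemma rangeResidual_apply_add (A : B →L[ℝ] X) (x : X) (h : B) :
    rangeResidual A (x + A h) = rangeResidual A x := by
  have : rangeResidual A (A h) = 0 := by
    rw [rangeResidual, Submodule.starProjection_apply_eq_zero_iff]
    exact Submodule.le_orthogonal_orthogonal _
      (Submodule.le_topologicalClosure _ ⟨h, rfl⟩)
  rw [map_add, this, add_zero]

/-- The residual is `x` minus its projection onto the closed range, and that projection is a limit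
of points `A h`. The slack `η` is there because the range need not be closed. -/
lemma exists_norm_add_lt (A : B →L[ℝ] X) (x : X) {η : ℝ} (hη : 0 < η) :
    ∃ h : B, ‖x + A h‖ < ‖rangeResidual A x‖ + η := by
  set K := (LinearMap.range (A : B →ₗ[ℝ] X)).topologicalClosure with hK
  have hc : IsClosed (K : Set X) := Submodule.isClosed_topologicalClosure _
  have : CompleteSpace K := hc.completeSpace_coe
  have hmem : K.starProjection x ∈ closure (LinearMap.range (A : B →ₗ[ℝ] X) : Set X) := by
    rw [← Submodule.topologicalClosure_coe]
    exact Submodule.starProjection_apply_mem K x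
  obtain ⟨_, ⟨h, rfl⟩, hd⟩ := Metric.mem_closure_iff.1 hmem η hη
  refine ⟨-h, ?_⟩
  have h1 : rangeResidual A x = x - K.starProjection x :=
    Submodule.starProjection_orthogonal_val x
  have h2 : x + A (-h) = rangeResidual A x + (K.starProjection x - A h) := by
    rw [h1, map_neg]; abel
  rw [h2]
  refine (norm_add_le _ _).trans_lt ?_
  rw [dist_eq_norm] at hd
  exact add_lt_add_right hd _

variable {ι κ : Type*} (j : κ → ι) (A : κ → B →L[ℝ] X)

/-- The functional `w ↦ inf_k ‖M_{A k} w(j k)‖`. -/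
def residualInf (w : ι → X) : ℝ := ⨅ k, ‖rangeResidual (A k) (w (j k))‖

variable [Nonempty κ]

lemma continuous_residualInf : Continuous fun w : LInf ι X => residualInf j A w := by
  refine (LipschitzWith.of_dist_le_mul (K := 1) fun w w' => ?_).continuous
  rw [NNReal.coe_one, one_mul, Real.dist_eq, dist_eq_norm]
  refine abs_iInf_sub_iInf_le (fun _ => norm_nonneg _) (fun _ => norm_nonneg _) fun k => ?_
  refine (abs_norm_sub_norm_le _ _).trans ?_
  rw [← map_sub]
  exact (norm_rangeResidual_le _ _).trans
    (lp.norm_apply_le_norm ENNReal.top_ne_zero (w - w') (j k))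

lemma residualInf_le_localInf {R : ℝ} (hR : 0 ≤ R) (w : ι → X) :
    residualInf j A w ≤ localInf j A R w := by
  have : Nonempty (Metric.closedBall (0 : B) R) := ⟨⟨0, Metric.mem_closedBall_self hR⟩⟩
  refine le_ciInf fun p => ?_
  refine (ciInf_le ⟨0, forall_mem_range.2 fun _ => norm_nonneg _⟩ p.1).trans ?_
  rw [← rangeResidual_apply_add (A p.1) (w (j p.1)) p.2]
  exact norm_rangeResidual_le _ _

/-- Choose `k` nearly optimal for the residual, then `h` with `A k h` nearly cancelling the range
component; every ball of radius at least `‖h‖` already sees this pair. -/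
lemma tendsto_localInf (w : ι → X) :
    Tendsto (fun R : ℕ => localInf j A R w) atTop (𝓝 (residualInf j A w)) := by
  rw [Metric.tendsto_atTop]
  intro ε hε
  obtain ⟨k, hk⟩ := exists_lt_of_ciInf_lt
    (show (⨅ k, ‖rangeResidual (A k) (w (j k))‖) < residualInf j A w + ε / 2 from
      lt_add_of_pos_right _ (half_pos hε))
  obtain ⟨h, hh⟩ := exists_norm_add_lt (A k) (w (j k)) (half_pos hε)
  obtain ⟨N, hN⟩ := exists_nat_ge ‖h‖
  refine ⟨N, fun R hR => ?_⟩
  have hmem : h ∈ Metric.closedBall (0 : B) (R : ℝ) := by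
    rw [mem_closedBall_zero_iff]
    exact hN.trans (Nat.cast_le.2 hR)
  have h1 : localInf j A R w ≤ ‖w (j k) + A k h‖ :=
    ciInf_le (f := fun p : κ × Metric.closedBall (0 : B) (R : ℝ) => ‖w (j p.1) + A p.1 p.2‖)
      ⟨0, forall_mem_range.2 fun _ => norm_nonneg _⟩ (k, ⟨h, hmem⟩)
  have h2 := residualInf_le_localInf j A R.cast_nonneg w
  rw [Real.dist_eq, abs_of_nonneg (sub_nonneg.2 h2)]
  linarith

end Residual

/-! ### Pairing with the dual unit ball -/

section Dual

variable {X : Type*} [NormedAddCommGroup X] [NormedSpace ℝ X]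

/-- Hahn–Banach supplies a norming functional of norm at most one. -/
lemma norm_le_of_forall_dual_le {x : X} {C : ℝ}
    (h : ∀ t ∈ Metric.closedBall (0 : StrongDual ℝ X) 1, |t x| ≤ C) : ‖x‖ ≤ C := by
  obtain ⟨g, hg, hgx⟩ := exists_dual_vector'' ℝ x
  have := h g (mem_closedBall_zero_iff.2 hg)
  rw [hgx] at this
  simpa using this

lemma abs_dual_apply_le {t : StrongDual ℝ X} (ht : t ∈ Metric.closedBall (0 : StrongDual ℝ X) 1)
    (x : X) : |t x| ≤ ‖x‖ := by
  have := t.le_of_opNorm_le (mem_closedBall_zero_iff.1 ht) x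
  simpa using this

/-- The support function of the dual unit ball is the norm. -/
lemma criterion_dual_closedBall {B : Type*} (f : B → X) (θ : B) :
    criterion (Metric.closedBall (0 : StrongDual ℝ X) 1) (fun θ t => t (f θ)) θ = ‖f θ‖ := by
  have : Nonempty (Metric.closedBall (0 : StrongDual ℝ X) 1) :=
    ⟨⟨0, Metric.mem_closedBall_self zero_le_one⟩⟩
  have hle : ∀ t : Metric.closedBall (0 : StrongDual ℝ X) 1, t.1 (f θ) ≤ ‖f θ‖ := fun t =>
    (le_abs_self _).trans (abs_dual_apply_le t.2 _)
  refine le_antisymm (ciSup_le hle) ?_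
  obtain ⟨g, hg, hgx⟩ := exists_dual_vector'' ℝ (f θ)
  have := le_ciSup (f := fun t : Metric.closedBall (0 : StrongDual ℝ X) 1 => t.1 (f θ))
    ⟨_, forall_mem_range.2 hle⟩ ⟨g, mem_closedBall_zero_iff.2 hg⟩
  simp only [hgx] at this
  exact this

/-- The isometric embedding of `L^∞(ι; X)` into `L^∞(ι × T)`, `T` the dual unit ball. -/
def dualPairing (ι : Type*) :
    LInf ι X →ₗᵢ[ℝ] LInf (ι × Metric.closedBall (0 : StrongDual ℝ X) 1) ℝ where
  toFun w := ⟨fun p => p.2.1 (w p.1), memℓp_infty ⟨‖w‖, forall_mem_range.2 fun p =>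
    (abs_dual_apply_le p.2.2 _).trans (lp.norm_apply_le_norm ENNReal.top_ne_zero w p.1)⟩⟩
  map_add' w w' := by ext p; exact map_add p.2.1 (w p.1) (w' p.1)
  map_smul' c w := by ext p; simp
  norm_map' w := by
    refine le_antisymm ?_ ?_
    · exact lp.norm_le_of_forall_le (norm_nonneg _) fun p =>
        (abs_dual_apply_le p.2.2 _).trans (lp.norm_apply_le_norm ENNReal.top_ne_zero w p.1)
    · refine lp.norm_le_of_forall_le (norm_nonneg _) fun i => ?_
      exact norm_le_of_forall_dual_le fun t ht =>
        lp.norm_apply_le_norm ENNReal.top_ne_zero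
          (⟨fun p => p.2.1 (w p.1), _⟩ : LInf (ι × Metric.closedBall (0 : StrongDual ℝ X) 1) ℝ)
          (i, ⟨t, ht⟩)

lemma isClosedEmbedding_dualPairing [CompleteSpace X] (ι : Type*) :
    IsClosedEmbedding (dualPairing (X := X) ι) :=
  (dualPairing ι).isometry.isClosedEmbedding

/-- A process whose pairing with the dual unit ball converges weakly to a tight limit in
`L^∞(ι × T)` converges weakly to a tight limit in `L^∞(ι; X)`. -/
lemma exists_convergesWeakly_of_pairing [CompleteSpace X] {ι : Type*} {Ω : ℕ → Type*}
    [∀ n, MeasurableSpace (Ω n)] {P : ∀ n, Measure (Ω n)} [∀ n, IsProbabilityMeasure (P n)]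
    {G : ∀ n, Ω n → LInf (ι × Metric.closedBall (0 : StrongDual ℝ X) 1) ℝ}
    {μ : Measure (LInf (ι × Metric.closedBall (0 : StrongDual ℝ X) 1) ℝ)}
    [IsProbabilityMeasure μ] (hμ : IsTightMeasureSet {μ}) (h : ConvergesWeakly P G μ)
    (Y : ∀ n, Ω n → ι → X) (hY : ∀ n ω p, G n ω p = p.2.1 (Y n ω p.1)) :
    ∃ (W : ∀ n, Ω n → LInf ι X) (ν : Measure (LInf ι X)), (∀ n ω i, W n ω i = Y n ω i) ∧
      IsProbabilityMeasure ν ∧ IsTightMeasureSet {ν} ∧ ConvergesWeakly P W ν := by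
  have : ∀ n, Nonempty (Ω n) := fun n => (P n).nonempty_of_neZero
  have hbdd : ∀ n ω i, ‖Y n ω i‖ ≤ ‖G n ω‖ := fun n ω i =>
    norm_le_of_forall_dual_le fun t ht => by
      have := lp.norm_apply_le_norm ENNReal.top_ne_zero (G n ω) (i, ⟨t, ht⟩)
      rwa [hY] at this
  let W : ∀ n, Ω n → LInf ι X := fun n ω =>
    ⟨Y n ω, memℓp_infty ⟨‖G n ω‖, forall_mem_range.2 (hbdd n ω)⟩⟩
  have hG : G = fun n ω => dualPairing ι (W n ω) := by
    funext n ω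
    ext p
    exact hY n ω p
  rw [hG] at h
  obtain ⟨ν, h1, h2, h3⟩ := h.exists_of_isClosedEmbedding (isClosedEmbedding_dualPairing ι) hμ
  exact ⟨W, ν, fun _ _ _ => rfl, h1, h2, h3⟩

end Dual

end MinimaxTest

end

namespace MinimaxTest

/-! ### Uniform continuity of the pseudometric -/

/-- On a compact space every neighbourhood of the diagonal is an entourage. That the set in question
is one follows from the triangle inequality through `(a, t)` and compactness of `T`, which makes the
estimate uniform in `t`. This turns `ρ`-equicontinuity into equicontinuity in the parameter alone.
-/
lemma exists_forall_dist_lt_pseudoMetric_lt {M T : Type*} [PseudoMetricSpace M] [CompactSpace M]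
    [TopologicalSpace T] [CompactSpace T] (ρ : PseudoMetric (M × T) ℝ)
    (hρ : ∀ x, Tendsto (fun y => ρ y x) (𝓝 x) (𝓝 0)) {δ : ℝ} (hδ : 0 < δ) :
    ∃ η : ℝ, 0 < η ∧ ∀ a b : M, dist a b < η → ∀ t : T, ρ (a, t) (b, t) < δ := by
  have key : {p : M × M | ∀ t ∈ (univ : Set T), ρ (p.1, t) (p.2, t) < δ} ∈ uniformity M := by
    rw [← nhdsSet_diagonal_eq_uniformity, mem_nhdsSet_iff_forall]
    rintro ⟨a, b⟩ hab
    obtain rfl : a = b := hab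
    refine isCompact_univ.eventually_forall_of_forall_eventually fun t _ => ?_
    have h1 : Tendsto (fun q : (M × M) × T => (q.1.1, q.2)) (𝓝 ((a, a), t)) (𝓝 (a, t)) :=
      Continuous.tendsto (by fun_prop) _
    have h2 : Tendsto (fun q : (M × M) × T => (q.1.2, q.2)) (𝓝 ((a, a), t)) (𝓝 (a, t)) :=
      Continuous.tendsto (by fun_prop) _
    filter_upwards [((hρ (a, t)).comp h1).eventually_lt_const (half_pos hδ),
      ((hρ (a, t)).comp h2).eventually_lt_const (half_pos hδ)] with q hq1 hq2
    have h3 := ρ.triangle (q.1.1, q.2) (a, t) (q.1.2, q.2)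
    rw [ρ.symm (a, t)] at h3
    simp only [Function.comp_apply] at hq1 hq2
    linarith
  obtain ⟨η, hη, h⟩ := Metric.mem_uniformity_dist.1 key
  exact ⟨η, hη, fun a b hab t => h hab t (mem_univ t)⟩

/-! ### The linearised criterion -/

section Linear

variable {B : Type*} [NormedAddCommGroup B] [NormedSpace ℝ B]
  {X : Type*} [NormedAddCommGroup X] [NormedSpace ℝ X]

/-- A positively homogeneous first-order approximation of `t ∘ m` is `t ∘ ∇m`. -/
lemma eq_fderiv_of_remainder {Θ : Set B} {m : B → X} {θ : B} (hθ : θ ∈ interior Θ)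
    (hm : DifferentiableAt ℝ m θ) (t : StrongDual ℝ X) {d : B → ℝ}
    (hd : ∀ c : ℝ, 0 ≤ c → ∀ h, d (c • h) = c * d h) {f : ℝ → ℝ} {C : ℝ}
    (hf : f =o[𝓝[>] 0] (fun δ : ℝ => δ))
    (hr : ∀ᶠ δ : ℝ in 𝓝[>] 0, ∀ θ' ∈ Θ, ‖θ' - θ‖ ≤ δ →
      |t (m θ') - t (m θ) - d (θ' - θ)| ≤ C * |f δ|) (h : B) :
    d h = t (fderiv ℝ m θ h) := by
  -- The added 1 keeps `a` positive when `h = 0`, so `s * a` tends to zero from the right and still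
  -- bounds `‖s • h‖`.
  set a : ℝ := ‖h‖ + 1
  have ha : 0 < a := by positivity
  have hlim : Tendsto (fun s : ℝ => t (s⁻¹ • (m (θ + s • h) - m θ))) (𝓝[>] 0)
      (𝓝 (t (fderiv ℝ m θ h))) :=
    (t.continuous.tendsto _).comp
      (hm.hasFDerivAt.hasLineDerivAt h).tendsto_slope_zero_right
  have hscale : Tendsto (fun s : ℝ => s * a) (𝓝[>] 0) (𝓝[>] 0) := by
    refine tendsto_nhdsWithin_iff.2 ⟨?_, ?_⟩
    · have : Tendsto (fun s : ℝ => s * a) (𝓝 0) (𝓝 (0 * a)) := tendsto_id.mul_const a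
      rw [zero_mul] at this
      exact this.mono_left nhdsWithin_le_nhds
    · filter_upwards [self_mem_nhdsWithin] with s hs
      exact mul_pos hs ha
  have hsmall : Tendsto (fun s : ℝ => C * |f (s * a) / (s * a)| * a) (𝓝[>] 0) (𝓝 0) := by
    have := ((hf.tendsto_div_nhds_zero.comp hscale).abs.const_mul C).mul_const a
    simpa using this
  have hmem : ∀ᶠ s : ℝ in 𝓝[>] 0, θ + s • h ∈ Θ := by
    have : Tendsto (fun s : ℝ => θ + s • h) (𝓝 0) (𝓝 (θ + (0 : ℝ) • h)) :=
      Continuous.tendsto (by fun_prop) _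
    rw [zero_smul, add_zero] at this
    exact (this.mono_left nhdsWithin_le_nhds) (mem_interior_iff_mem_nhds.1 hθ)
  have hdist : Tendsto (fun s : ℝ => t (s⁻¹ • (m (θ + s • h) - m θ)) - d h) (𝓝[>] 0) (𝓝 0) := by
    refine squeeze_zero_norm' ?_ hsmall
    filter_upwards [self_mem_nhdsWithin, hmem, hscale.eventually hr] with s hs hsΘ hsr
    have hs0 : (0 : ℝ) < s := hs
    have h1 := hsr _ hsΘ (by
      rw [add_sub_cancel_left, norm_smul, Real.norm_of_nonneg hs0.le]
      exact mul_le_mul_of_nonneg_left (by simp [a]) hs0.le)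
    rw [add_sub_cancel_left, hd s hs0.le] at h1
    have h2 : t (s⁻¹ • (m (θ + s • h) - m θ)) - d h =
        s⁻¹ * (t (m (θ + s • h)) - t (m θ) - s * d h) := by
      rw [map_smul, map_sub, smul_eq_mul]; field_simp
    rw [h2, norm_mul, Real.norm_of_nonneg (inv_nonneg.2 hs0.le), Real.norm_eq_abs, abs_div,
      abs_of_pos (mul_pos hs0 ha)]
    calc s⁻¹ * |t (m (θ + s • h)) - t (m θ) - s * d h| ≤ s⁻¹ * (C * |f (s * a)|) := by gcongr
      _ = C * (|f (s * a)| / (s * a)) * a := by field_simp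
  have := tendsto_nhds_unique hlim (by simpa using hdist.add_const (d h))
  exact this.symm

/-- For linear derivatives and interior `θ`, `γ(θ, t)` vanishes only if the derivative does. -/
lemma gammaFun_eq_zero_iff {E : Type*} {Θ : Set B} {θ : B} (hθ : θ ∈ interior Θ)
    (D : B → E → B → ℝ) (t : E) (L : StrongDual ℝ B) (hL : ∀ h, D θ t h = L h) :
    gammaFun Θ D θ t = 0 ↔ ∀ h, L h = 0 := by
  constructor
  · intro hγ
    by_contra! hne
    obtain ⟨h₀, hh₀⟩ := hne
    obtain ⟨h, hn, hneg⟩ : ∃ h : B, ‖h‖ ≤ 1 ∧ L h < 0 := by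
      have h0 : h₀ ≠ 0 := by rintro rfl; exact hh₀ (map_zero L)
      have hpos : 0 < ‖h₀‖ := norm_pos_iff.2 h0
      -- Normalise `h₀` and flip its sign, so that `L` takes the value `-|L h₀| / ‖h₀‖`.
      refine ⟨(-(SignType.sign (L h₀) : ℝ) * ‖h₀‖⁻¹) • h₀, ?_, ?_⟩
      · rw [norm_smul, norm_mul, norm_neg, norm_inv, norm_norm, mul_assoc,
          inv_mul_cancel₀ hpos.ne', mul_one]
        rcases lt_or_gt_of_ne hh₀ with h | h <;> simp [h]
      · rw [map_smul, smul_eq_mul]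
        have : -(SignType.sign (L h₀) : ℝ) * ‖h₀‖⁻¹ * L h₀ = -(‖h₀‖⁻¹ * |L h₀|) := by
          rw [← sign_mul_self (L h₀)]; ring
        rw [this, neg_lt_zero]
        have := abs_pos.2 hh₀
        positivity
    have hmem : ∀ᶠ s : ℝ in 𝓝[>] 0, θ + s • h ∈ Θ := by
      have : Tendsto (fun s : ℝ => θ + s • h) (𝓝 0) (𝓝 (θ + (0 : ℝ) • h)) :=
        Continuous.tendsto (by fun_prop) _
      rw [zero_smul, add_zero] at this
      exact (this.mono_left nhdsWithin_le_nhds) (mem_interior_iff_mem_nhds.1 hθ)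
    have hle : gammaFun Θ D θ t ≤ ((L h : ℝ) : EReal) := by
      rw [← liminf_const (f := 𝓝[>] (0 : ℝ)) ((L h : ℝ) : EReal)]
      refine liminf_le_liminf ?_
      filter_upwards [self_mem_nhdsWithin, hmem] with s hs hsΘ
      have hs0 : (0 : ℝ) < s := hs
      -- Along this ray the quotient equals `L h` for every `s`, so the negative value survives in
      -- the liminf.
      refine (iInf₂_le (θ + s • h) ⟨hsΘ, ?_⟩).trans ?_
      · rw [add_sub_cancel_left, hL, map_smul, smul_eq_mul, mul_div_cancel_left₀ _ hs0.ne']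
      · rw [add_sub_cancel_left, norm_smul, Real.norm_of_nonneg hs0.le]
        exact mul_le_of_le_one_right hs0.le hn
    rw [hγ] at hle
    exact absurd (EReal.coe_nonneg.1 hle) hneg.not_ge
  · intro h0
    rw [gammaFun, ← liminf_const (f := 𝓝[>] (0 : ℝ)) (0 : EReal)]
    refine liminf_congr ?_
    filter_upwards [self_mem_nhdsWithin] with s hs
    have hs0 : (0 : ℝ) < s := hs
    simp only [hL, h0, zero_div, EReal.coe_zero]
    exact biInf_const ⟨θ, interior_subset hθ, by simpa using hs0.le⟩

end Linear

/-! ### Local upper bound for the test statistic -/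

section Local

variable {B : Type*} [NormedAddCommGroup B] [NormedSpace ℝ B]
  {X : Type*} [NormedAddCommGroup X] [NormedSpace ℝ X]

/-- Deterministic core of the upper bound: one `ε` pays for linearising `m`, the other for the
oscillation of `r (mn - m)` between `θ` and its perturbation. -/
lemma mul_iInf_norm_le_localInf {Θ Θ₀ : Set B} [Nonempty {θ : Θ // (θ : B) ∈ Θ₀}] {m mn : B → X}
    (A : B → B →L[ℝ] X) {r R ε : ℝ} (hr : 0 < r) (hR : 0 ≤ R) (hm : ∀ θ ∈ Θ₀, m θ = 0)
    (hball : ∀ θ ∈ Θ₀, ∀ θ', ‖θ' - θ‖ ≤ R / r → θ' ∈ Θ)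
    (hrem : ∀ θ ∈ Θ₀, ∀ θ' ∈ Θ, ‖θ' - θ‖ ≤ R / r →
      r * ‖m θ' - m θ - A θ (θ' - θ)‖ ≤ ε)
    (hosc : ∀ θ ∈ Θ₀, θ ∈ Θ → ∀ θ' ∈ Θ, ‖θ' - θ‖ ≤ R / r →
      ‖r • (mn θ' - m θ') - r • (mn θ - m θ)‖ ≤ ε) :
    r * ⨅ θ : Θ, ‖mn θ‖ ≤
      localInf (Subtype.val : {θ : Θ // (θ : B) ∈ Θ₀} → Θ) (fun k => A k.1) R
        (fun θ : Θ => r • (mn θ - m θ)) + 2 * ε := by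
  have : Nonempty (Metric.closedBall (0 : B) R) := ⟨⟨0, Metric.mem_closedBall_self hR⟩⟩
  rw [← sub_le_iff_le_add]
  refine le_ciInf ?_
  rintro ⟨⟨⟨θ, hθΘ⟩, hθ⟩, ⟨h, hh⟩⟩
  rw [mem_closedBall_zero_iff] at hh
  dsimp only at hθ ⊢
  rw [sub_le_iff_le_add]
  set θ' := θ + r⁻¹ • h with hθ'
  have hsub : θ' - θ = r⁻¹ • h := add_sub_cancel_left _ _
  have hdist : ‖θ' - θ‖ ≤ R / r := by
    rw [hsub, norm_smul, norm_inv, Real.norm_of_nonneg hr.le, div_eq_inv_mul]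
    gcongr
  have hmem : θ' ∈ Θ := hball θ hθ θ' hdist
  have h1 : r • mn θ' = (r • (mn θ - m θ) + A θ h) + r • (m θ' - m θ - A θ (θ' - θ)) +
      (r • (mn θ' - m θ') - r • (mn θ - m θ)) := by
    rw [hsub, map_smul, hm θ hθ]
    simp only [smul_sub, smul_inv_smul₀ hr.ne', smul_zero]
    abel
  calc r * ⨅ θ : Θ, ‖mn θ‖ ≤ r * ‖mn θ'‖ := by
        gcongr
        exact ciInf_le (f := fun θ : Θ => ‖mn θ‖)
          ⟨0, forall_mem_range.2 fun _ => norm_nonneg _⟩ ⟨θ', hmem⟩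
    _ = ‖r • mn θ'‖ := by rw [norm_smul, Real.norm_of_nonneg hr.le]
    _ ≤ ‖r • (mn θ - m θ) + A θ h‖ + ‖r • (m θ' - m θ - A θ (θ' - θ))‖ +
        ‖r • (mn θ' - m θ') - r • (mn θ - m θ)‖ := by rw [h1]; exact norm_add₃_le
    _ ≤ ‖r • (mn θ - m θ) + A θ h‖ + ε + ε := by
        gcongr
        · rw [norm_smul, Real.norm_of_nonneg hr.le]
          exact hrem θ hθ θ' hmem hdist
        · exact hosc θ hθ hθΘ θ' hmem hdist
    _ = _ := by ring

end Local

end MinimaxTest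

namespace MinimaxTest

/-! ### Stochastic bound -/

/-- If `Z n ≤ localInf k (W n) + 2 ε` outside of events of small outer probability, for every `ε`
and `k`, then `Z n ≤ residualInf (W n) + o_p(1)`. -/
lemma isLittleOp_max_sub_residualInf {Ω : ℕ → Type*} [∀ n, MeasurableSpace (Ω n)]
    {P : ∀ n, Measure (Ω n)} [∀ n, IsProbabilityMeasure (P n)]
    {B : Type*} [NormedAddCommGroup B] [NormedSpace ℝ B]
    {X : Type*} [NormedAddCommGroup X] [InnerProductSpace ℝ X] [CompleteSpace X]
    {ι κ : Type*} [Nonempty κ] (j : κ → ι) (A : κ → B →L[ℝ] X)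
    {W : ∀ n, Ω n → LInf ι X} {ν : Measure (LInf ι X)} [IsProbabilityMeasure ν]
    (hW : ConvergesWeakly P W ν) (Z : ∀ n, Ω n → ℝ)
    (hZ : ∀ (k : ℕ) (ε : ℝ), 0 < ε → ∀ η : ℝ≥0∞, 0 < η → ∀ᶠ n in atTop,
      P n {ω | localInf j A k (W n ω) + 2 * ε < Z n ω} < η) :
    IsLittleOp P fun n ω => max 0 (Z n ω - residualInf j A (W n ω)) := by
  intro ε hε
  rw [ENNReal.tendsto_nhds_zero]
  intro η hη
  have hη2 : 0 < η / 2 := ENNReal.half_pos hη.ne'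
  obtain ⟨k, hk⟩ := hW.exists_eventually_measure_lt
    (H := fun (k : ℕ) w => localInf j A k w - residualInf j A w)
    (fun k => (continuous_localInf j A k.cast_nonneg).sub (continuous_residualInf j A))
    (fun k w => sub_nonneg.2 (residualInf_le_localInf j A k.cast_nonneg w))
    (fun w => by simpa using (tendsto_localInf j A w).sub_const (residualInf j A w))
    (half_pos hε) hη2
  filter_upwards [hk, hZ k (ε / 4) (by positivity) _ hη2] with n h1 h2
  calc P n {ω | ε < |max 0 (Z n ω - residualInf j A (W n ω))|}
      ≤ P n ({ω | ε / 2 ≤ localInf j A k (W n ω) - residualInf j A (W n ω)} ∪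
          {ω | localInf j A k (W n ω) + 2 * (ε / 4) < Z n ω}) := by
        -- Off both events the excess is below `ε / 2 + 2 * (ε / 4) = ε`.
        refine measure_mono fun ω hω => ?_
        rw [mem_ofPred_eq, abs_of_nonneg (le_max_left _ _), lt_max_iff] at hω
        rw [mem_union, mem_ofPred_eq, mem_ofPred_eq]
        by_contra! hcon
        rcases hω with hω | hω <;> linarith [hcon.1, hcon.2]
    _ ≤ η / 2 + η / 2 := (measure_union_le _ _).trans (add_le_add h1.le h2.le)
    _ = η := ENNReal.add_halves η

section Main

variable {B : Type*} [NormedAddCommGroup B] [NormedSpace ℝ B]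
  {X : Type*} [NormedAddCommGroup X] [InnerProductSpace ℝ X]
  {Ω : ℕ → Type*} [∀ n, MeasurableSpace (Ω n)] {P : ∀ n, Measure (Ω n)}

/-- On the dual unit ball, asymptotic equicontinuity of the pairing gives equicontinuity in norm
along `Θ`, uniformly over shrinking balls. -/
lemma exists_eventually_measure_norm_sub_lt {M : Type*} [PseudoMetricSpace M] [CompactSpace M]
    [TopologicalSpace (Metric.closedBall (0 : StrongDual ℝ X) 1)]
    [CompactSpace (Metric.closedBall (0 : StrongDual ℝ X) 1)]
    {ρ : PseudoMetric (M × Metric.closedBall (0 : StrongDual ℝ X) 1) ℝ}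
    (hρ : ∀ x, Tendsto (fun y => ρ y x) (𝓝 x) (𝓝 0)) {Y : ∀ n, Ω n → M → X}
    (h : AsymptoticallyEquicontinuous P ρ fun n ω p => p.2.1 (Y n ω p.1))
    {ε : ℝ} (hε : 0 < ε) {η : ℝ≥0∞} (hη : 0 < η) : ∃ τ : ℝ, 0 < τ ∧
      ∀ᶠ n in atTop, P n {ω | ∃ a b, dist a b < τ ∧ ε < ‖Y n ω a - Y n ω b‖} < η := by
  obtain ⟨δ, hδ, hlim⟩ := h ε hε η hη
  obtain ⟨τ, hτ, hτρ⟩ := exists_forall_dist_lt_pseudoMetric_lt ρ hρ hδ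
  refine ⟨τ, hτ, ?_⟩
  filter_upwards [eventually_lt_of_limsup_lt hlim] with n hn
  refine (measure_mono ?_).trans_lt hn
  rintro ω ⟨a, b, hab, hY⟩
  -- A norm increment above `ε` is detected by a single functional `t`, giving two points of `M × T`
  -- with the same second coordinate.
  by_contra hcon
  refine hY.not_ge (norm_le_of_forall_dual_le fun t ht => ?_)
  by_contra! ht'
  exact hcon ⟨(a, ⟨t, ht⟩), (b, ⟨t, ht⟩), hτρ a b hab _, by rwa [map_sub] at ht'⟩

/-- The statistic is asymptotically bounded by the local infimum over any fixed ball. -/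
lemma eventually_measure_localInf_lt {Θ Θ₀ : Set B} [Nonempty {θ : Θ // (θ : B) ∈ Θ₀}]
    {m : B → X} {mn : ∀ n, Ω n → B → X}
    (A : B → B →L[ℝ] X) (hm : ∀ θ ∈ Θ₀, m θ = 0) {r : ℕ → ℝ} (hr : Tendsto r atTop atTop)
    {κ : ℝ} (hκ : 0 < κ) (hball : ∀ θ ∈ Θ₀, ∀ θ', ‖θ' - θ‖ ≤ κ → θ' ∈ Θ)
    (hrem : ∀ c : ℝ, 0 < c → ∀ᶠ δ : ℝ in 𝓝[>] 0, ∀ θ ∈ Θ₀, ∀ θ' ∈ Θ, ‖θ' - θ‖ ≤ δ →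
      ‖m θ' - m θ - A θ (θ' - θ)‖ ≤ c * δ)
    (hosc : ∀ (ε : ℝ), 0 < ε → ∀ η : ℝ≥0∞, 0 < η → ∃ τ : ℝ, 0 < τ ∧
      ∀ᶠ n in atTop, P n {ω | ∃ a b : Θ, dist a b < τ ∧
        ε < ‖r n • (mn n ω a - m a) - r n • (mn n ω b - m b)‖} < η)
    (k : ℕ) {ε : ℝ} (hε : 0 < ε) {η : ℝ≥0∞} (hη : 0 < η) :
    ∀ᶠ n in atTop, P n {ω | localInf (Subtype.val : {θ : Θ // (θ : B) ∈ Θ₀} → Θ)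
      (fun θ => A θ.1) k (fun θ : Θ => r n • (mn n ω θ - m θ)) + 2 * ε <
        r n * ⨅ θ : Θ, ‖mn n ω θ‖} < η := by
  -- Using `k + 1` keeps the radius positive when `k = 0`; the remainder constant `ε / (k + 1)`
  -- compensates.
  have hk : (0 : ℝ) < k + 1 := by positivity
  have hscale : Tendsto (fun n => (k + 1 : ℝ) / r n) atTop (𝓝[>] 0) := by
    refine tendsto_nhdsWithin_iff.2 ⟨hr.const_div_atTop _, ?_⟩
    filter_upwards [hr.eventually_gt_atTop 0] with n hn using div_pos hk hn
  obtain ⟨τ, hτ, hτP⟩ := hosc ε hε η hη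
  have hsmall : ∀ c : ℝ, 0 < c → ∀ᶠ n in atTop, (k + 1 : ℝ) / r n < c := fun c hc =>
    (hscale.mono_right nhdsWithin_le_nhds).eventually_lt_const hc
  filter_upwards [hτP, hsmall τ hτ, hsmall κ hκ, hr.eventually_gt_atTop 0,
    hscale.eventually (hrem (ε / (k + 1)) (by positivity))] with n hP hnτ hnκ hrn hnr
  refine (measure_mono ?_).trans_lt hP
  intro ω hω
  by_contra hcon
  have hkr : (k : ℝ) / r n ≤ (k + 1) / r n := by gcongr; linarith
  refine hω.not_ge (mul_iInf_norm_le_localInf A hrn k.cast_nonneg hm ?_ ?_ ?_)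
  · exact fun θ hθ θ' hd => hball θ hθ θ' ((hd.trans hkr).trans hnκ.le)
  · intro θ hθ θ' hθ' hd
    have := hnr θ hθ θ' hθ' (hd.trans hkr)
    calc r n * ‖m θ' - m θ - A θ (θ' - θ)‖ ≤ r n * (ε / (k + 1) * ((k + 1) / r n)) := by gcongr
      _ = ε := by field_simp
  · intro θ hθ hθΘ θ' hθ' hd
    by_contra! hlt
    refine hcon ⟨⟨θ', hθ'⟩, ⟨θ, hθΘ⟩, ?_, hlt⟩
    rw [Subtype.dist_eq, dist_eq_norm]
    exact (hd.trans hkr).trans_lt hnτ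

end Main

/-- A uniform remainder bound over the dual unit ball gives one in norm. -/
lemma eventually_norm_remainder_le {B : Type*} [NormedAddCommGroup B] [NormedSpace ℝ B]
    {X : Type*} [NormedAddCommGroup X] [NormedSpace ℝ X] {Θ Θ₀ : Set B} {m : B → X}
    {A : B → B →L[ℝ] X} {f : ℝ → ℝ} {C : ℝ} (hf : f =o[𝓝[>] 0] (fun δ : ℝ => δ))
    (hr : ∀ᶠ δ : ℝ in 𝓝[>] 0, ∀ θ ∈ Θ₀, ∀ θ' ∈ Θ, ∀ t ∈ Metric.closedBall (0 : StrongDual ℝ X) 1,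
      ‖θ' - θ‖ ≤ δ → |t (m θ') - t (m θ) - t (A θ (θ' - θ))| ≤ C * |f δ|) {c : ℝ} (hc : 0 < c) :
    ∀ᶠ δ : ℝ in 𝓝[>] 0, ∀ θ ∈ Θ₀, ∀ θ' ∈ Θ, ‖θ' - θ‖ ≤ δ →
      ‖m θ' - m θ - A θ (θ' - θ)‖ ≤ c * δ := by
  have hCf : (fun δ => C * f δ) =o[𝓝[>] 0] (fun δ : ℝ => δ) := hf.const_mul_left C
  filter_upwards [hr, hCf.bound hc, self_mem_nhdsWithin] with δ h1 h2 hδ θ hθ θ' hθ' hd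
  have hδ0 : (0 : ℝ) < δ := hδ
  refine norm_le_of_forall_dual_le fun t ht => ?_
  rw [map_sub, map_sub]
  rw [Real.norm_of_nonneg hδ0.le, Real.norm_eq_abs, abs_mul] at h2
  calc _ ≤ C * |f δ| := h1 θ hθ θ' hθ' t ht hd
    _ ≤ |C| * |f δ| := by gcongr; exact le_abs_self C
    _ ≤ c * δ := h2

end MinimaxTest

/-! ### Assembly of the theorem. -/

theorem mainTheorem7
    {B : Type*} [NormedAddCommGroup B] [NormedSpace ℝ B] [CompleteSpace B]
    {X : Type*} [NormedAddCommGroup X] [InnerProductSpace ℝ X] [CompleteSpace X]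
    {Ω : ℕ → Type*} [∀ n, MeasurableSpace (Ω n)]
    (P : ∀ n, Measure (Ω n)) [∀ n, IsProbabilityMeasure (P n)]
    (Θ : Set B) (m : B → X) (hm : DifferentiableOn ℝ m Θ)
    (mn : ∀ n, Ω n → B → X) (r : ℕ → ℝ)
    (T : Set (StrongDual ℝ X)) (hT : T = Metric.closedBall 0 1)
    (v : B → StrongDual ℝ X → ℝ) (hv : ∀ θ t, v θ t = t (m θ))
    (vn : ∀ n, Ω n → B → StrongDual ℝ X → ℝ) (hvn : ∀ n ω θ t, vn n ω θ t = t (mn n ω θ))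
    (D : B → StrongDual ℝ X → B → ℝ)
    (ρ : PseudoMetric (Θ × T) ℝ) (U : TopologicalSpace T)
    (Θ₀ : Set B) (hΘ₀ : Θ₀ = MinimaxTest.identifiedSet Θ T v)
    (h_model : MinimaxTest.RegularModel Θ T v)
    (h_clt : MinimaxTest.EmpiricalCLT P Θ T v vn r ρ)
    (h_diff : MinimaxTest.UniformlyApproximable P Θ T v vn D)
    (h_tests : MinimaxTest.CompactTests P Θ T v vn D ρ U)
    (h_nonempty : Θ₀.Nonempty) (h_interior : Θ₀ ⊆ interior Θ) :
    -- the criterion is the norm of the moment function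
    (∀ θ ∈ Θ, MinimaxTest.criterion T v θ = ‖m θ‖) ∧
    -- `K(θ)` consists of the functionals in `T` annihilating the image of the derivative
    (∀ θ ∈ Θ₀, MinimaxTest.zeroSet Θ T D θ = {t ∈ T | ∀ h : B, t (fderiv ℝ m θ h) = 0}) ∧
    -- the upper bound for the test statistic
    (∃ R : ∀ n, Ω n → ℝ, MinimaxTest.IsLittleOp P R ∧
      ∀ n ω, MinimaxTest.testStatistic Θ T (r n) (vn n ω) ≤
        (⨅ θ : Θ₀, ‖MinimaxTest.residualProj m θ (r n • (mn n ω θ - m θ))‖) + R n ω) ∧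
    -- `r_n (m_n - m)` has a tight weak limit in `L^∞(Θ; X)`, and the bound converges weakly to
    -- the same functional of that limit
    (∃ (W : ∀ n, Ω n → MinimaxTest.LInf Θ X) (ν : Measure (MinimaxTest.LInf Θ X)),
      (∀ n ω (θ : Θ), W n ω θ = r n • (mn n ω θ - m θ)) ∧
      IsProbabilityMeasure ν ∧ IsTightMeasureSet {ν} ∧
      MinimaxTest.ConvergesWeakly P W ν ∧
      MinimaxTest.ConvergesWeakly P
        (fun n ω => ⨅ θ : Θ₀, ‖MinimaxTest.residualProj m θ (r n • (mn n ω θ - m θ))‖)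
        (ν.map fun w => ⨅ θ : {θ : Θ // (θ : B) ∈ Θ₀}, ‖MinimaxTest.residualProj m θ (w θ)‖)) := by
  subst hT
  obtain rfl : v = fun θ t => t (m θ) := by funext θ t; exact hv θ t
  obtain rfl : vn = fun n ω θ t => t (mn n ω θ) := by funext n ω θ t; exact hvn n ω θ t
  have hcrit : ∀ (g : B → X) (θ : B), MinimaxTest.criterion
      (Metric.closedBall (0 : StrongDual ℝ X) 1) (fun θ t => t (g θ)) θ = ‖g θ‖ :=
    fun g θ => MinimaxTest.criterion_dual_closedBall g θ
  have hmem : ∀ θ, θ ∈ Θ₀ ↔ θ ∈ Θ ∧ m θ = 0 := fun θ => by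
    rw [hΘ₀, MinimaxTest.identifiedSet, mem_ofPred_eq, hcrit, norm_eq_zero]
  have hsub : Θ₀ ⊆ Θ := fun θ hθ => ((hmem θ).1 hθ).1
  have hzero : ∀ θ ∈ Θ₀, m θ = 0 := fun θ hθ => ((hmem θ).1 hθ).2
  obtain ⟨f, hf, C, hrem⟩ := h_diff.remainder
  rw [← hΘ₀] at hrem
  have hD : ∀ θ ∈ Θ₀, ∀ t ∈ Metric.closedBall (0 : StrongDual ℝ X) 1, ∀ h,
      D θ t h = t (fderiv ℝ m θ h) := by
    intro θ hθ t ht h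
    refine MinimaxTest.eq_fderiv_of_remainder (h_interior hθ)
      (hm.differentiableAt (mem_interior_iff_mem_nhds.1 (h_interior hθ))) t
      (h_diff.posHomogeneous θ (hΘ₀ ▸ hθ) t ht) hf (C := C) ?_ h
    filter_upwards [hrem] with δ hδ θ' hθ' hd
    exact hδ θ hθ θ' hθ' t ht hd
  -- Compactness of the zero set gives one radius `κ` for which all perturbations of identified
  -- points stay in `Θ`.
  have hcompact : IsCompact Θ₀ := by
    have : Θ₀ = Θ ∩ m ⁻¹' {0} := by ext θ; exact hmem θ
    rw [this]
    exact h_model.isCompact.of_isClosed_subset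
      (hm.continuousOn.preimage_isClosed_of_isClosed h_model.isCompact.isClosed isClosed_singleton)
      inter_subset_left
  obtain ⟨κ, hκ, hκΘ⟩ := hcompact.exists_cthickening_subset_open isOpen_interior h_interior
  have hball : ∀ θ ∈ Θ₀, ∀ θ', ‖θ' - θ‖ ≤ κ → θ' ∈ Θ := fun θ hθ θ' hd =>
    interior_subset (hκΘ (Metric.mem_cthickening_of_dist_le θ' θ κ Θ₀ hθ (by rwa [dist_eq_norm])))
  obtain ⟨θ₀, hθ₀⟩ := h_nonempty
  have hne : Nonempty {θ : Θ // (θ : B) ∈ Θ₀} := ⟨⟨⟨θ₀, hsub hθ₀⟩, hθ₀⟩⟩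
  obtain ⟨G, μ, hG, hμp, hμt, hGμ⟩ := h_clt.weak_limit
  have hproc : ∀ n ω (p : Θ × Metric.closedBall (0 : StrongDual ℝ X) 1),
      MinimaxTest.empiricalProcess Θ (Metric.closedBall (0 : StrongDual ℝ X) 1)
        (fun θ t => t (m θ)) (fun n ω θ t => t (mn n ω θ)) r n ω p =
      p.2.1 (r n • (mn n ω p.1 - m p.1)) := fun n ω p => by
    rw [map_smul, map_sub, smul_eq_mul, MinimaxTest.empiricalProcess]
  obtain ⟨W, ν, hW, hνp, hνt, hWν⟩ := MinimaxTest.exists_convergesWeakly_of_pairing hμt hGμ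
    (fun n ω (θ : Θ) => r n • (mn n ω θ - m θ)) (fun n ω p => by rw [hG, hproc])
  have hWfun : ∀ n ω, ⇑(W n ω) = fun θ : Θ => r n • (mn n ω θ - m θ) := fun n ω =>
    funext (hW n ω)
  have := h_tests.compactSpace
  have : CompactSpace Θ := isCompact_iff_compactSpace.1 h_model.isCompact
  have hequi := h_clt.equicontinuous
  rw [show MinimaxTest.empiricalProcess Θ (Metric.closedBall (0 : StrongDual ℝ X) 1)
      (fun θ t => t (m θ)) (fun n ω θ t => t (mn n ω θ)) r =
      fun n ω p => p.2.1 (r n • (mn n ω p.1 - m p.1)) by funext n ω p; exact hproc n ω p] at hequi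
  set j : {θ : Θ // (θ : B) ∈ Θ₀} → Θ := Subtype.val with hj
  set A : {θ : Θ // (θ : B) ∈ Θ₀} → B →L[ℝ] X := fun θ => fderiv ℝ m θ.1 with hA
  -- The infimum is reindexed from `Θ₀` to the part of the subtype `Θ` lying in `Θ₀`, since `W` is
  -- indexed by `Θ`.
  have hres : ∀ n ω, (⨅ θ : Θ₀, ‖MinimaxTest.residualProj m θ (r n • (mn n ω θ - m θ))‖) =
      MinimaxTest.residualInf j A (W n ω) := by
    intro n ω
    refine Equiv.iInf_congr (Equiv.subtypeSubtypeEquivSubtype fun {θ} hθ => hsub hθ).symm ?_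
    rintro ⟨θ, hθ⟩
    rw [hWfun]
    rfl
  refine ⟨fun θ _ => hcrit m θ, ?_, ?_, W, ν, hW, hνp, hνt, hWν, ?_⟩
  · intro θ hθ
    ext t
    refine and_congr_right fun ht => ?_
    exact MinimaxTest.gammaFun_eq_zero_iff (h_interior hθ) D t (t.comp (fderiv ℝ m θ))
      (hD θ hθ t ht)
  -- Taking the positive part of the excess as remainder makes the inequality hold for every `ω`;
  -- only its `o_p(1)` property needs proof.
  · refine ⟨fun n ω => max 0 (MinimaxTest.testStatistic Θ (Metric.closedBall 0 1) (r n)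
      (fun θ (t : StrongDual ℝ X) => t (mn n ω θ)) - MinimaxTest.residualInf j A (W n ω)), ?_, ?_⟩
    · refine MinimaxTest.isLittleOp_max_sub_residualInf j A hWν _ fun k ε hε η hη => ?_
      simp only [hWfun, MinimaxTest.testStatistic, hcrit]
      refine MinimaxTest.eventually_measure_localInf_lt (fderiv ℝ m) hzero h_clt.tendsto_rate
        hκ hball ?_ ?_ k hε hη
      · intro c hc
        refine MinimaxTest.eventually_norm_remainder_le hf (C := C) ?_ hc
        filter_upwards [hrem] with δ hδ θ hθ θ' hθ' t ht hd
        rw [← hD θ hθ t ht]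
        exact hδ θ hθ θ' hθ' t ht hd
      · intro ε hε η hη
        exact MinimaxTest.exists_eventually_measure_norm_sub_lt h_tests.continuous
          (Y := fun n ω (θ : Θ) => r n • (mn n ω θ - m θ)) hequi hε hη
    · intro n ω
      rw [hres]
      linarith [le_max_right 0 (MinimaxTest.testStatistic Θ (Metric.closedBall 0 1) (r n)
        (fun θ (t : StrongDual ℝ X) => t (mn n ω θ)) - MinimaxTest.residualInf j A (W n ω))]
  · simp only [hres]
    have hmap : (fun w : MinimaxTest.LInf Θ X => ⨅ θ : {θ : Θ // (θ : B) ∈ Θ₀},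
        ‖MinimaxTest.residualProj m θ (w θ)‖) =
        fun w : MinimaxTest.LInf Θ X => MinimaxTest.residualInf j A w := rfl
    rw [hmap]
    exact hWν.comp (g := fun w : MinimaxTest.LInf Θ X => MinimaxTest.residualInf j A w)
      (MinimaxTest.continuous_residualInf j A)
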